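/- **Setting.** Simple types are generated by $A,B ::= \mathtt{o} \mid A\Rightarrow B \mid A\times B \mid 1$. Let $\mathbf{Lam}$ be the cartesian closed category (CCC) whose objects are the simple types and whose morphisms $A\to B$ are the closed simply typed $\lambda$-terms (with pairs, projections and the element $\langle\rangle:1$) of type $A\Rightarrow B$, modulo $\beta\eta$-conversion, with the usual composition, products and exponentials. Let $\mathbf{FinOrd}$ be the CCC whose objects are the natural numbers and whose morphisms $n\to n'$ are the maps $\{1,\dots,n\}\to\{1,\dots,n'\}$, with terminal object $1$, product $n\cdot n'$ and exponential $n\Rightarrow n' = n'^{\,n}$. Let $\mathcal R$ be the CCC of logical relations from $\mathbf{Lam}$ to $\mathbf{FinOrd}$. Its objects are the triples $(B,n,\Vdash)$ with $B$ a simple type, $n$ a natural number and $\Vdash$ a relation between the points $1\to B$ of $\mathbf{Lam}$ (that is, closed terms of type $B$ modulo $\beta\eta$) and the points $1\to n$ of $\mathbf{FinOrd}$ (that is, elements of $\{1,\dots,n\}$). A morphism $(B,n,\Vdash)\to(B',n',\Vdash')$ is a pair of morphisms $f:B\to B'$ and $g:n\to n'$ such that $x\Vdash y$ implies $f\circ x\Vdash'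 g\circ y$. Terminal object, products and exponentials are those of $\mathbf{Lam}\times\mathbf{FinOrd}$, equipped with the following relations: the total one on $1$; on a product, two points are related when both their components are; on an exponential, two points are related when they send related points to related points. A morphism $(f,g)$ of $\mathcal R$ is a *target-identity* if $n=n'$ and $g=\mathrm{id}_n$. For $n\ge 0$, write $\mathtt{o}^n$ for the $n$-fold product of $\mathtt{o}$ (with $\mathtt{o}^0=1$ and $\mathtt{o}^1=\mathtt{o}$), let $\pi_i$ be the $\lambda$-term $\lambda(x:\mathtt{o}^n).\,x_i$ for $1\le i\le n$, and let $\mathrm{Bij}(n)$ be the object $(\mathtt{o}^n\Rightarrow\mathtt{o},\ n,\ \{(\pi_i,i) : 1\le i\le n\})$ of $\mathcal R$. A *squeezing structure* on a CCC $\mathcal C$ consists of * two wide subcategories of $\mathcal C$, whose morphisms are called left and right morphisms, each stable under finite products of morphisms, and such that for every left morphism $u:c_l\to c_l'$ and every right morphism $v:c_r\to c_r'$, the morphism $v\Rightarrow u : (c_r'\Rightarrow c_l)\to(c_r\Rightarrow c_l')$ is left and the morphism $u\Rightarrow v : (c_l'\Rightarrow c_r)\to(c_l\Rightarrow c_r')$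 is right; * for every object $c$, two objects $L_c$ and $R_c$ such that, for all objects $c,c'$, there exist left morphisms $L_1\to 1$, $L_{c\times c'}\to L_c\times L_{c'}$, $L_{c\Rightarrow c'}\to (R_c\Rightarrow L_{c'})$ and right morphisms $1\to R_1$, $R_c\times R_{c'}\to R_{c\times c'}$, $(L_c\Rightarrow R_{c'})\to R_{c\Rightarrow c'}$. **Proposition.** There is a squeezing structure on $\mathcal R$ such that * the left morphisms and the right morphisms are both exactly the target-identities of $\mathcal R$; * for every object $c=(B,n,\Vdash)$ of $\mathcal R$, $L_c=R_c=\mathrm{Bij}(n)$. -/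

import Mathlib

open CategoryTheory MonoidalCategory CartesianMonoidalCategory

universe v u v₁ u₁ v₂ u₂

namespace LamRel

/-! ## Auxiliary constructors for cartesian closed categories -/

section Builders

variable {C : Type u} [Category.{v} C]

/-- A cartesian monoidal structure from specified finite products. -/
@[reducible] def mkCartesian (unit : C) (toUnit : ∀ X : C, X ⟶ unit)
    (toUnit_uniq : ∀ {X : C} (f g : X ⟶ unit), f = g)
    (prod : C → C → C) (fst : ∀ X Y : C, prod X Y ⟶ X) (snd : ∀ X Y : C, prod X Y ⟶ Y)
    (lift : ∀ {T X Y : C}, (T ⟶ X) → (T ⟶ Y) → (T ⟶ prod X Y))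
    (lift_fst : ∀ {T X Y : C} (f : T ⟶ X) (g : T ⟶ Y), lift f g ≫ fst X Y = f)
    (lift_snd : ∀ {T X Y : C} (f : T ⟶ X) (g : T ⟶ Y), lift f g ≫ snd X Y = g)
    (lift_uniq : ∀ {T X Y : C} (h h' : T ⟶ prod X Y),
      h ≫ fst X Y = h' ≫ fst X Y → h ≫ snd X Y = h' ≫ snd X Y → h = h') :
    CartesianMonoidalCategory C :=
  CartesianMonoidalCategory.ofChosenFiniteProducts
    ⟨_, Limits.IsTerminal.ofUniqueHom toUnit (fun _ _ => toUnit_uniq _ _)⟩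
    (fun X Y => ⟨Limits.BinaryFan.mk (fst X Y) (snd X Y),
      Limits.BinaryFan.IsLimit.mk _ (fun f g => lift f g) (fun f g => lift_fst f g)
        (fun f g => lift_snd f g)
        (fun f g _ hf hg => lift_uniq _ _ (hf.trans (lift_fst f g).symm)
          (hg.trans (lift_snd f g).symm))⟩)

/-- A closed structure from specified exponentials, evaluations and currying. -/
@[reducible] def mkClosed [MonoidalCategory C] (exp : C → C → C)
    (ev : ∀ A B : C, A ⊗ exp A B ⟶ B)
    (curry : ∀ {A Y B : C}, (A ⊗ Y ⟶ B) → (Y ⟶ exp A B))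
    (beta : ∀ {A Y B : C} (f : A ⊗ Y ⟶ B), A ◁ curry f ≫ ev A B = f)
    (eta : ∀ {A Y B : C} (g : Y ⟶ exp A B), curry (A ◁ g ≫ ev A B) = g) :
    MonoidalClosed C where
  closed A :=
    have uniq : ∀ {Y B : C} (g g' : Y ⟶ exp A B), A ◁ g ≫ ev A B = A ◁ g' ≫ ev A B → g = g' :=
      fun g g' h => (eta g).symm.trans ((congrArg curry h).trans (eta g'))
    { rightAdj :=
        { obj := exp A
          map := fun g => curry (ev A _ ≫ g)
          map_id := fun B => uniq _ _ (by
            rw [beta, MonoidalCategory.whiskerLeft_id, Category.comp_id, Category.id_comp])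
          map_comp := fun f g => uniq _ _ (by
            rw [beta, MonoidalCategory.whiskerLeft_comp, Category.assoc, beta,
              ← Category.assoc, ← Category.assoc, beta]) }
      adj := Adjunction.mkOfUnitCounit
        { unit :=
            { app := fun Y => curry (𝟙 (A ⊗ Y))
              naturality := fun Y Y' f => uniq _ _ (by
                change A ◁ (f ≫ curry (𝟙 (A ⊗ Y'))) ≫ ev A (A ⊗ Y')
                  = A ◁ (curry (𝟙 (A ⊗ Y)) ≫ curry (ev A (A ⊗ Y) ≫ A ◁ f)) ≫ ev A (A ⊗ Y')
                rw [MonoidalCategory.whiskerLeft_comp, MonoidalCategory.whiskerLeft_comp,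
                  Category.assoc, Category.assoc, beta, beta, ← Category.assoc, beta,
                  Category.comp_id, Category.id_comp]) }
          counit :=
            { app := fun B => ev A B
              naturality := fun _ _ _ => beta _ }
          left_triangle := by
            ext Y
            simp [beta]
          right_triangle := by
            ext B
            apply uniq
            have h : A ◁ curry (𝟙 (A ⊗ exp A B)) ≫ ev A (A ⊗ exp A B) ≫ ev A B = ev A B := by
              rw [← Category.assoc, beta, Category.id_comp]
            simpa [beta] using h } }

end Builders

/-! ## The product of two cartesian closed categories -/

section Product

variable {C₁ : Type u₁} [Category.{v₁} C₁] [CartesianMonoidalCategory C₁]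
  {C₂ : Type u₂} [Category.{v₂} C₂] [CartesianMonoidalCategory C₂]

/-- Finite products in `C₁ × C₂` are computed componentwise. -/
instance prodCartesian : CartesianMonoidalCategory (C₁ × C₂) where
  toMonoidalCategory := MonoidalCategory.prodMonoidal C₁ C₂
  isTerminalTensorUnit := Limits.IsTerminal.ofUniqueHom
    (fun X => (toUnit X.1, toUnit X.2))
    (fun _ _ => Prod.hom_ext (toUnit_unique _ _) (toUnit_unique _ _))
  fst X Y := (fst X.1 Y.1, fst X.2 Y.2)
  snd X Y := (snd X.1 Y.1, snd X.2 Y.2)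
  fst_def X Y := Prod.hom_ext (fst_def X.1 Y.1) (fst_def X.2 Y.2)
  snd_def X Y := Prod.hom_ext (snd_def X.1 Y.1) (snd_def X.2 Y.2)
  tensorProductIsBinaryProduct X Y := Limits.BinaryFan.IsLimit.mk _
    (fun f g => (lift f.1 g.1, lift f.2 g.2))
    (fun f g => Prod.hom_ext (lift_fst f.1 g.1) (lift_fst f.2 g.2))
    (fun f g => Prod.hom_ext (lift_snd f.1 g.1) (lift_snd f.2 g.2))
    (fun f g m hf hg => by
      subst hf hg
      exact Prod.hom_ext (lift_comp_fst_snd m.1).symm (lift_comp_fst_snd m.2).symm)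

/-- Exponentials in `C₁ × C₂` are computed componentwise. -/
instance prodClosed [MonoidalClosed C₁] [MonoidalClosed C₂] : MonoidalClosed (C₁ × C₂) :=
  mkClosed (fun A B => ((ihom A.1).obj B.1, (ihom A.2).obj B.2))
    (fun A B => ((ihom.ev A.1).app B.1, (ihom.ev A.2).app B.2))
    (fun {A Y B} f => (MonoidalClosed.curry (A := A.1) (Y := Y.1) (X := B.1) f.1,
      MonoidalClosed.curry (A := A.2) (Y := Y.2) (X := B.2) f.2))
    (fun {A Y B} f => Prod.hom_ext
      (MonoidalClosed.whiskerLeft_curry_ihom_ev_app (A := A.1) (Y := Y.1) (X := B.1) f.1)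
      (MonoidalClosed.whiskerLeft_curry_ihom_ev_app (A := A.2) (Y := Y.2) (X := B.2) f.2))
    (fun {A Y B} g => Prod.hom_ext
      (MonoidalClosed.curry_uncurry (A := A.1) (X := Y.1) (Y := B.1) g.1)
      (MonoidalClosed.curry_uncurry (A := A.2) (X := Y.2) (Y := B.2) g.2))

end Product

/-! ## Logical predicates and logical relations -/

section Pred

/-- An object of the category of logical predicates over `C`: an object of `C` together with
a set of its points. -/
structure Pred (C : Type u) [Category.{v} C] [CartesianMonoidalCategory C] where
  obj : C
  pred : Set (𝟙_ C ⟶ obj)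

variable {C : Type u} [Category.{v} C] [CartesianMonoidalCategory C]

namespace Pred

/-- A morphism of logical predicates: a morphism of `C` that sends points satisfying the first
predicate to points satisfying the second one. -/
@[ext] structure Hom (X Y : Pred C) where
  hom : X.obj ⟶ Y.obj
  map_pred : ∀ x ∈ X.pred, x ≫ hom ∈ Y.pred

instance : Category (Pred C) where
  Hom := Hom
  id X := ⟨𝟙 X.obj, fun x hx => by simpa using hx⟩
  comp f g := ⟨f.hom ≫ g.hom, fun x hx => by
    simpa using g.map_pred _ (f.map_pred x hx)⟩

@[ext] theorem hom_ext {X Y : Pred C} {f g : X ⟶ Y} (h : f.hom = g.hom) : f = g :=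
  Hom.ext h

@[simp] theorem id_hom (X : Pred C) : Hom.hom (𝟙 X) = 𝟙 X.obj := rfl

@[simp] theorem comp_hom {X Y Z : Pred C} (f : X ⟶ Y) (g : Y ⟶ Z) :
    (f ≫ g).hom = f.hom ≫ g.hom := rfl

instance : CartesianMonoidalCategory (Pred C) :=
  mkCartesian ⟨𝟙_ C, Set.univ⟩ (fun X => ⟨toUnit X.obj, fun _ _ => trivial⟩)
    (fun _ _ => Pred.hom_ext (toUnit_unique _ _))
    (fun X Y => ⟨X.obj ⊗ Y.obj,
      {p | p ≫ fst X.obj Y.obj ∈ X.pred ∧ p ≫ snd X.obj Y.obj ∈ Y.pred}⟩)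
    (fun X Y => ⟨fst X.obj Y.obj, fun _ hp => hp.1⟩)
    (fun X Y => ⟨snd X.obj Y.obj, fun _ hp => hp.2⟩)
    (fun f g => ⟨lift f.hom g.hom, fun x hx => by
      constructor
      · simpa using f.map_pred x hx
      · simpa using g.map_pred x hx⟩)
    (fun f g => Pred.hom_ext (lift_fst f.hom g.hom))
    (fun f g => Pred.hom_ext (lift_snd f.hom g.hom))
    (fun h h' h₁ h₂ => Pred.hom_ext
      (CartesianMonoidalCategory.hom_ext _ _ (congrArg Hom.hom h₁) (congrArg Hom.hom h₂)))

theorem whiskerLeft_hom (X : Pred C) {Y Z : Pred C} (f : Y ⟶ Z) :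
    (X ◁ f).hom = X.obj ◁ f.hom := by
  change lift (fst X.obj Y.obj ≫ 𝟙 X.obj) (snd X.obj Y.obj ≫ f.hom) = _
  ext <;> simp

variable [MonoidalClosed C]

/-- The exponential of logical predicates: a point of the exponential satisfies the predicate
when, evaluated at any point satisfying the first predicate, it gives a point satisfying the
second one. -/
def exp (X Y : Pred C) : Pred C where
  obj := (ihom X.obj).obj Y.obj
  pred := {f | ∀ s ∈ X.pred, lift s f ≫ (ihom.ev X.obj).app Y.obj ∈ Y.pred}

instance : MonoidalClosed (Pred C) :=
  mkClosed exp
    (fun X Y => ⟨(ihom.ev X.obj).app Y.obj,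
      fun (p : 𝟙_ C ⟶ X.obj ⊗ (ihom X.obj).obj Y.obj) hp => by
      have h : lift (p ≫ fst X.obj ((ihom X.obj).obj Y.obj))
          (p ≫ snd X.obj ((ihom X.obj).obj Y.obj)) ≫ (ihom.ev X.obj).app Y.obj ∈ Y.pred :=
        hp.2 _ hp.1
      rw [lift_comp_fst_snd] at h
      exact h⟩)
    (fun {X Z Y} f => ⟨MonoidalClosed.curry (A := X.obj) (Y := Z.obj) (X := Y.obj) f.hom,
      fun z hz s hs => by
        have h : lift s z ≫ f.hom ∈ Y.pred :=
          f.map_pred (lift s z) ⟨by simpa using hs, by simpa using hz⟩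
        have e : lift s (z ≫ MonoidalClosed.curry (A := X.obj) (Y := Z.obj) (X := Y.obj) f.hom)
            ≫ (ihom.ev X.obj).app Y.obj = lift s z ≫ f.hom := by
          rw [← lift_whiskerLeft, Category.assoc]
          exact congrArg _ (MonoidalClosed.whiskerLeft_curry_ihom_ev_app
            (A := X.obj) (Y := Z.obj) (X := Y.obj) f.hom)
        exact Set.mem_of_eq_of_mem e h⟩)
    (fun {X Z Y} f => Pred.hom_ext (by
      rw [comp_hom, whiskerLeft_hom]
      exact MonoidalClosed.whiskerLeft_curry_ihom_ev_app
        (A := X.obj) (Y := Z.obj) (X := Y.obj) f.hom))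
    (fun {X Z Y} g => Pred.hom_ext (by
      change MonoidalClosed.curry (A := X.obj) (Y := Z.obj) (X := Y.obj)
        ((X ◁ g).hom ≫ (ihom.ev X.obj).app Y.obj) = g.hom
      rw [whiskerLeft_hom]
      exact MonoidalClosed.curry_uncurry (A := X.obj) (X := Z.obj) (Y := Y.obj) g.hom))

end Pred

/-- The cartesian closed category of logical relations from `C₁` to `C₂`. Since a point of
`(c₁, c₂)` is a pair of points, its objects are triples consisting of an object of `C₁`, an object
of `C₂` and a relation between their points. -/
abbrev LogRel (C₁ : Type u₁) [Category.{v₁} C₁] [CartesianMonoidalCategory C₁]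
    (C₂ : Type u₂) [Category.{v₂} C₂] [CartesianMonoidalCategory C₂] :=
  Pred (C₁ × C₂)

/-- The target-identities: the morphisms of logical relations between objects with the same
second component, whose own second component is the identity morphism. -/
def targetIdentities (C₁ : Type u₁) [Category.{v₁} C₁] [CartesianMonoidalCategory C₁]
    (C₂ : Type u₂) [Category.{v₂} C₂] [CartesianMonoidalCategory C₂] :
    MorphismProperty (LogRel C₁ C₂) :=
  fun X Y f => ∃ h : X.obj.2 = Y.obj.2, f.hom.2 = eqToHom h

end Pred

/-! ## Squeezing structures -/

section Squeezing

variable {C : Type u} [Category.{v} C] [CartesianMonoidalCategory C] [MonoidalClosed C]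

/-- The functorial action `f ⇒ g : b ⇒ c ⟶ a ⇒ d` of the exponential, contravariant in
`f : a ⟶ b` and covariant in `g : c ⟶ d`. -/
def expMap {a b c d : C} (f : a ⟶ b) (g : c ⟶ d) : (ihom b).obj c ⟶ (ihom a).obj d :=
  (MonoidalClosed.pre f).app c ≫ (ihom a).map g

/-- A squeezing structure on a cartesian closed category. A wide subcategory is given as the
class of its morphisms, which contains the identities and is closed under composition. -/
structure SqueezingStructure (C : Type u) [Category.{v} C] [CartesianMonoidalCategory C]
    [MonoidalClosed C] where
  /-- the left morphisms -/
  left : MorphismProperty C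
  /-- the right morphisms -/
  right : MorphismProperty C
  left_multiplicative : left.IsMultiplicative
  right_multiplicative : right.IsMultiplicative
  left_prod : ∀ {a b a' b' : C} (u : a ⟶ b) (u' : a' ⟶ b'), left u → left u' → left (u ⊗ₘ u')
  right_prod : ∀ {a b a' b' : C} (v : a ⟶ b) (v' : a' ⟶ b'),
    right v → right v' → right (v ⊗ₘ v')
  left_exp : ∀ {l l' r r' : C} (u : l ⟶ l') (v : r ⟶ r'),
    left u → right v → left (expMap v u)
  right_exp : ∀ {l l' r r' : C} (u : l ⟶ l') (v : r ⟶ r'),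
    left u → right v → right (expMap u v)
  /-- the lower bounds -/
  L : C → C
  /-- the upper bounds -/
  R : C → C
  L_unit : ∃ f : L (𝟙_ C) ⟶ 𝟙_ C, left f
  L_prod : ∀ c c' : C, ∃ f : L (c ⊗ c') ⟶ L c ⊗ L c', left f
  L_exp : ∀ c c' : C, ∃ f : L ((ihom c).obj c') ⟶ (ihom (R c)).obj (L c'), left f
  R_unit : ∃ f : 𝟙_ C ⟶ R (𝟙_ C), right f
  R_prod : ∀ c c' : C, ∃ f : R c ⊗ R c' ⟶ R (c ⊗ c'), right f
  R_exp : ∀ c c' : C, ∃ f : (ihom (L c)).obj (R c') ⟶ R ((ihom c).obj c'), right f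

end Squeezing

/-! ## Finite ordinals -/

/-- The category of finite ordinals: its objects are the natural numbers, a morphism from `n` to
`m` is a map from the finite cardinal `n` to the finite cardinal `m`. -/
structure FinOrd where
  card : ℕ

namespace FinOrd

@[ext] structure Hom (X Y : FinOrd) where
  toFun : Fin X.card → Fin Y.card

instance : Category FinOrd where
  Hom := Hom
  id _ := ⟨id⟩
  comp f g := ⟨g.toFun ∘ f.toFun⟩

@[ext] theorem hom_ext {X Y : FinOrd} {f g : X ⟶ Y} (h : ∀ i, f.toFun i = g.toFun i) : f = g :=
  Hom.ext (funext h)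

@[simp] theorem id_toFun (X : FinOrd) (i) : Hom.toFun (𝟙 X) i = i := rfl

@[simp] theorem comp_toFun {X Y Z : FinOrd} (f : X ⟶ Y) (g : Y ⟶ Z) (i) :
    (f ≫ g).toFun i = g.toFun (f.toFun i) := rfl

/-- The product of `n` and `m` is `n * m`. -/
instance : CartesianMonoidalCategory FinOrd :=
  mkCartesian ⟨1⟩ (fun _ => ⟨fun _ => 0⟩)
    (fun _ _ => FinOrd.hom_ext fun _ => Subsingleton.elim (α := Fin 1) _ _)
    (fun X Y => ⟨X.card * Y.card⟩)
    (fun _ _ => ⟨fun p => (finProdFinEquiv.symm p).1⟩)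
    (fun _ _ => ⟨fun p => (finProdFinEquiv.symm p).2⟩)
    (fun f g => ⟨fun t => finProdFinEquiv (f.toFun t, g.toFun t)⟩)
    (fun f g => FinOrd.hom_ext fun t =>
      congrArg Prod.fst (finProdFinEquiv.symm_apply_apply (f.toFun t, g.toFun t)))
    (fun f g => FinOrd.hom_ext fun t =>
      congrArg Prod.snd (finProdFinEquiv.symm_apply_apply (f.toFun t, g.toFun t)))
    (fun _ _ h₁ h₂ => FinOrd.hom_ext fun t => finProdFinEquiv.symm.injective
      (Prod.ext (congrFun (congrArg Hom.toFun h₁) t) (congrFun (congrArg Hom.toFun h₂) t)))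

theorem whiskerLeft_toFun (X : FinOrd) {Y Z : FinOrd} (f : Y ⟶ Z) (p : Fin (X.card * Y.card)) :
    (X ◁ f).toFun p = finProdFinEquiv ((finProdFinEquiv.symm p).1,
      f.toFun (finProdFinEquiv.symm p).2) := rfl

/-- The exponential of `m` by `n` is `m ^ n`. -/
instance : MonoidalClosed FinOrd :=
  mkClosed (fun X Y => ⟨Y.card ^ X.card⟩)
    (fun X Y => ⟨fun p : Fin (X.card * Y.card ^ X.card) =>
      finFunctionFinEquiv.symm (finProdFinEquiv.symm p).2 (finProdFinEquiv.symm p).1⟩)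
    (fun f => ⟨fun y => finFunctionFinEquiv fun a => f.toFun (finProdFinEquiv (a, y))⟩)
    (fun {X Y Z} f => FinOrd.hom_ext fun (p : Fin (X.card * Y.card)) => by
      rw [comp_toFun, whiskerLeft_toFun]
      change finFunctionFinEquiv.symm (finProdFinEquiv.symm (finProdFinEquiv _)).2
        (finProdFinEquiv.symm (finProdFinEquiv _)).1 = _
      rw [Equiv.symm_apply_apply, Equiv.symm_apply_apply, Prod.mk.eta, Equiv.apply_symm_apply])
    (fun {X Y Z} g => FinOrd.hom_ext fun y => by
      change finFunctionFinEquiv (fun a => finFunctionFinEquiv.symm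
        (finProdFinEquiv.symm ((X ◁ g).toFun (finProdFinEquiv (a, y)))).2
        (finProdFinEquiv.symm ((X ◁ g).toFun (finProdFinEquiv (a, y)))).1) = _
      simp only [whiskerLeft_toFun, Equiv.symm_apply_apply]
      exact Equiv.apply_symm_apply _ _)

/-- The point of the finite ordinal `n` given by an element of the finite cardinal `n`. -/
def point {n : ℕ} (i : Fin n) : 𝟙_ FinOrd ⟶ ⟨n⟩ :=
  ⟨fun _ => i⟩

end FinOrd

/-! ## The simply typed lambda-calculus with products -/

/-- Simple types over one base type, with function types, binary products and a unit type. -/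
inductive Ty : Type
  | o : Ty
  | arr : Ty → Ty → Ty
  | prod : Ty → Ty → Ty
  | unit : Ty

/-- `Var Γ A` is the type of (de Bruijn) variables of type `A` in the context `Γ`. -/
inductive Var : List Ty → Ty → Type
  | zero {Γ : List Ty} {A : Ty} : Var (A :: Γ) A
  | succ {Γ : List Ty} {A B : Ty} : Var Γ A → Var (B :: Γ) A

/-- `Term Γ A` is the type of lambda-terms of type `A` in the context `Γ`. -/
inductive Term : List Ty → Ty → Type
  | var {Γ : List Ty} {A : Ty} : Var Γ A → Term Γ A
  | lam {Γ : List Ty} {A B : Ty} : Term (A :: Γ) B → Term Γ (Ty.arr A B)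
  | app {Γ : List Ty} {A B : Ty} : Term Γ (Ty.arr A B) → Term Γ A → Term Γ B
  | pair {Γ : List Ty} {A B : Ty} : Term Γ A → Term Γ B → Term Γ (Ty.prod A B)
  | fst {Γ : List Ty} {A B : Ty} : Term Γ (Ty.prod A B) → Term Γ A
  | snd {Γ : List Ty} {A B : Ty} : Term Γ (Ty.prod A B) → Term Γ B
  | star {Γ : List Ty} : Term Γ Ty.unit

/-- Renamings of variables. -/
abbrev Ren (Γ Δ : List Ty) : Type := ∀ A : Ty, Var Γ A → Var Δ A

/-- A renaming extended under a binder. -/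
def Ren.lift {Γ Δ : List Ty} (ρ : Ren Γ Δ) (B : Ty) : Ren (B :: Γ) (B :: Δ)
  | _, Var.zero => Var.zero
  | _, Var.succ x => Var.succ (ρ _ x)

/-- The weakening renaming. -/
def Ren.wk (Γ : List Ty) (B : Ty) : Ren Γ (B :: Γ) := fun _ x => Var.succ x

/-- The only renaming out of the empty context. -/
def Ren.nil (Γ : List Ty) : Ren [] Γ := fun _ x => nomatch x

/-- Simultaneous substitutions. -/
abbrev Sub (Γ Δ : List Ty) : Type := ∀ A : Ty, Var Γ A → Term Δ A

namespace Term

/-- The action of a renaming on a term. -/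
def ren {Γ Δ : List Ty} {A : Ty} (ρ : Ren Γ Δ) : Term Γ A → Term Δ A
  | var x => var (ρ _ x)
  | lam t => lam (ren (ρ.lift _) t)
  | app t u => app (ren ρ t) (ren ρ u)
  | pair t u => pair (ren ρ t) (ren ρ u)
  | fst t => fst (ren ρ t)
  | snd t => snd (ren ρ t)
  | star => star

/-- Weakening by one variable. -/
def wk {Γ : List Ty} {A : Ty} (B : Ty) (t : Term Γ A) : Term (B :: Γ) A := t.ren (Ren.wk Γ B)

end Term

/-- A substitution extended under a binder. -/
def Sub.lift {Γ Δ : List Ty} (σ : Sub Γ Δ) (B : Ty) : Sub (B :: Γ) (B :: Δ)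
  | _, Var.zero => Term.var Var.zero
  | _, Var.succ x => (σ _ x).wk B

/-- The substitution of a term for the most recent variable. -/
def Sub.inst {Γ : List Ty} {B : Ty} (u : Term Γ B) : Sub (B :: Γ) Γ
  | _, Var.zero => u
  | _, Var.succ x => Term.var x

/-- The substitution for the only variable of a one-variable context. -/
def Sub.one {Γ : List Ty} {B : Ty} (u : Term Γ B) : Sub [B] Γ
  | _, Var.zero => u

namespace Term

/-- Capture-avoiding simultaneous substitution. -/
def sub {Γ Δ : List Ty} {A : Ty} (σ : Sub Γ Δ) : Term Γ A → Term Δ A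
  | var x => σ _ x
  | lam t => lam (sub (σ.lift _) t)
  | app t u => app (sub σ t) (sub σ u)
  | pair t u => pair (sub σ t) (sub σ u)
  | fst t => fst (sub σ t)
  | snd t => snd (sub σ t)
  | star => star

end Term

open Term in
/-- `βη`-conversion: the least congruence containing the `β`- and `η`-rules of function, product
and unit types. -/
inductive Conv : {Γ : List Ty} → {A : Ty} → Term Γ A → Term Γ A → Prop
  | refl {Γ : List Ty} {A : Ty} (t : Term Γ A) : Conv t t
  | symm {Γ : List Ty} {A : Ty} {t u : Term Γ A} : Conv t u → Conv u t
  | trans {Γ : List Ty} {A : Ty} {t u v : Term Γ A} : Conv t u → Conv u v → Conv t v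
  | lam {Γ : List Ty} {A B : Ty} {t t' : Term (A :: Γ) B} : Conv t t' → Conv (lam t) (lam t')
  | app {Γ : List Ty} {A B : Ty} {t t' : Term Γ (Ty.arr A B)} {u u' : Term Γ A} :
      Conv t t' → Conv u u' → Conv (app t u) (app t' u')
  | pair {Γ : List Ty} {A B : Ty} {t t' : Term Γ A} {u u' : Term Γ B} :
      Conv t t' → Conv u u' → Conv (pair t u) (pair t' u')
  | fst {Γ : List Ty} {A B : Ty} {t t' : Term Γ (Ty.prod A B)} :
      Conv t t' → Conv (fst t) (fst t')
  | snd {Γ : List Ty} {A B : Ty} {t t' : Term Γ (Ty.prod A B)} :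
      Conv t t' → Conv (snd t) (snd t')
  | beta {Γ : List Ty} {A B : Ty} (t : Term (A :: Γ) B) (u : Term Γ A) :
      Conv (app (lam t) u) (t.sub (Sub.inst u))
  | beta_fst {Γ : List Ty} {A B : Ty} (t : Term Γ A) (u : Term Γ B) : Conv (fst (pair t u)) t
  | beta_snd {Γ : List Ty} {A B : Ty} (t : Term Γ A) (u : Term Γ B) : Conv (snd (pair t u)) u
  | eta {Γ : List Ty} {A B : Ty} (t : Term Γ (Ty.arr A B)) :
      Conv t (lam (app (t.wk A) (var Var.zero)))
  | eta_pair {Γ : List Ty} {A B : Ty} (t : Term Γ (Ty.prod A B)) : Conv t (pair (fst t) (snd t))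
  | eta_star {Γ : List Ty} (t : Term Γ Ty.unit) : Conv t star

/-! ### Substitution lemmas -/

section SubstitutionLemmas

variable {Γ Δ Θ : List Ty} {A B : Ty}

theorem Ren.lift_comp (ρ : Ren Γ Δ) (ρ' : Ren Δ Θ) (B : Ty) :
    (fun A x => ρ'.lift B A (ρ.lift B A x)) = Ren.lift (fun A x => ρ' A (ρ A x)) B := by
  funext A x; cases x <;> rfl

theorem Sub.lift_ren (ρ : Ren Γ Δ) (σ : Sub Δ Θ) (B : Ty) :
    (fun A x => σ.lift B A (ρ.lift B A x)) = Sub.lift (fun A x => σ A (ρ A x)) B := by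
  funext A x; cases x <;> rfl

theorem Sub.lift_var (ρ : Ren Γ Δ) (B : Ty) :
    (fun A x => Term.var (ρ.lift B A x)) = Sub.lift (fun A x => Term.var (ρ A x)) B := by
  funext A x; cases x <;> rfl

namespace Term

theorem ren_ren (t : Term Γ A) : ∀ {Δ Θ : List Ty} (ρ : Ren Γ Δ) (ρ' : Ren Δ Θ),
    (t.ren ρ).ren ρ' = t.ren (fun A x => ρ' A (ρ A x)) := by
  induction t with
  | lam t ih => intro _ _ ρ ρ'; simp only [ren]; rw [ih, Ren.lift_comp]
  | _ => intros; simp_all only [ren]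

theorem sub_ren (t : Term Γ A) : ∀ {Δ Θ : List Ty} (ρ : Ren Γ Δ) (σ : Sub Δ Θ),
    (t.ren ρ).sub σ = t.sub (fun A x => σ A (ρ A x)) := by
  induction t with
  | lam t ih => intro _ _ ρ σ; simp only [ren, sub]; rw [ih, Sub.lift_ren]
  | _ => intros; simp_all only [ren, sub]

theorem ren_eq_sub (t : Term Γ A) : ∀ {Δ : List Ty} (ρ : Ren Γ Δ),
    t.ren ρ = t.sub (fun A x => var (ρ A x)) := by
  induction t with
  | lam t ih => intro _ ρ; simp only [ren, sub]; rw [ih, Sub.lift_var]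
  | _ => intros; simp_all only [ren, sub]

theorem wk_ren (t : Term Γ A) (ρ : Ren Γ Δ) (B : Ty) :
    (t.wk B).ren (ρ.lift B) = (t.ren ρ).wk B := by
  simp only [wk, ren_ren]; rfl

end Term

theorem Sub.ren_lift (σ : Sub Γ Δ) (ρ : Ren Δ Θ) (B : Ty) :
    (fun A x => (σ.lift B A x).ren (ρ.lift B)) = Sub.lift (fun A x => (σ A x).ren ρ) B := by
  funext A x
  cases x with
  | zero => rfl
  | succ x => exact Term.wk_ren _ _ _

namespace Term

theorem ren_sub (t : Term Γ A) : ∀ {Δ Θ : List Ty} (σ : Sub Γ Δ) (ρ : Ren Δ Θ),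
    (t.sub σ).ren ρ = t.sub (fun A x => (σ A x).ren ρ) := by
  induction t with
  | lam t ih => intro _ _ σ ρ; simp only [ren, sub]; rw [ih, Sub.ren_lift]
  | _ => intros; simp_all only [ren, sub]

theorem sub_var (t : Term Γ A) : t.sub (fun _ x => var x) = t := by
  induction t with
  | lam t ih =>
    simp only [sub]
    rw [← Sub.lift_var (fun _ x => x)]
    refine congrArg lam (Eq.trans (congrArg (fun σ => sub σ t) ?_) ih)
    funext A x; cases x <;> rfl
  | _ => simp_all only [sub]

theorem wk_sub_inst (t : Term Γ A) (u : Term Γ B) : (t.wk B).sub (Sub.inst u) = t := by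
  rw [wk, sub_ren]; exact sub_var t

/-- All renamings and substitutions agree on closed terms. -/
theorem ren_closed (t : Term [] A) (ρ : Ren [] Γ) : t.ren ρ = t.ren (Ren.nil Γ) :=
  congrArg (fun r => t.ren r) (funext fun _ => funext fun x => nomatch x)

theorem sub_closed (t : Term [] A) (σ : Sub [] Γ) : t.sub σ = t.ren (Ren.nil Γ) := by
  rw [ren_eq_sub]
  exact congrArg (fun s => t.sub s) (funext fun _ => funext fun x => nomatch x)

end Term

theorem Conv.ren {t u : Term Γ A} (h : Conv t u) :
    ∀ {Δ : List Ty} (ρ : Ren Γ Δ), Conv (t.ren ρ) (u.ren ρ) := by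
  induction h with
  | refl t => intro _ ρ; exact .refl _
  | symm _ ih => intro _ ρ; exact .symm (ih ρ)
  | trans _ _ ih ih' => intro _ ρ; exact .trans (ih ρ) (ih' ρ)
  | lam _ ih => intro _ ρ; exact .lam (ih _)
  | app _ _ ih ih' => intro _ ρ; exact .app (ih ρ) (ih' ρ)
  | pair _ _ ih ih' => intro _ ρ; exact .pair (ih ρ) (ih' ρ)
  | fst _ ih => intro _ ρ; exact .fst (ih ρ)
  | snd _ ih => intro _ ρ; exact .snd (ih ρ)
  | beta t u =>
    intro _ ρ
    have e : (t.sub (Sub.inst u)).ren ρ = (t.ren (ρ.lift _)).sub (Sub.inst (u.ren ρ)) := by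
      rw [Term.ren_sub, Term.sub_ren]
      refine congrArg (fun s => t.sub s) ?_
      funext A x; cases x <;> rfl
    rw [e]
    exact .beta _ _
  | beta_fst t u => intro _ ρ; exact .beta_fst _ _
  | beta_snd t u => intro _ ρ; exact .beta_snd _ _
  | eta t =>
    intro _ ρ
    have e := Conv.eta (t.ren ρ)
    rw [← Term.wk_ren] at e
    exact e
  | eta_pair t => intro _ ρ; exact .eta_pair _
  | eta_star t => intro _ ρ; exact .eta_star _

end SubstitutionLemmas

/-! ### Terms modulo conversion -/

/-- `βη`-conversion as a setoid. -/
def convSetoid (Γ : List Ty) (A : Ty) : Setoid (Term Γ A) :=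
  ⟨Conv, Conv.refl, Conv.symm, Conv.trans⟩

/-- Terms in context, modulo `βη`-conversion. -/
def OTm (Γ : List Ty) (A : Ty) : Type := Quotient (convSetoid Γ A)

/-- Closed terms, modulo `βη`-conversion. -/
abbrev Tm (A : Ty) : Type := OTm [] A

/-- The class of a term modulo `βη`-conversion. -/
def Term.cls {Γ : List Ty} {A : Ty} (t : Term Γ A) : OTm Γ A := Quotient.mk _ t

namespace OTm

variable {Γ Δ Θ : List Ty} {A B : Ty}

theorem ind {p : OTm Γ A → Prop} (h : ∀ t : Term Γ A, p t.cls) (t : OTm Γ A) : p t :=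
  Quotient.ind h t

theorem sound {t u : Term Γ A} (h : Conv t u) : t.cls = u.cls := Quotient.sound h

/-- Variables. -/
def var (x : Var Γ A) : OTm Γ A := (Term.var x).cls

/-- Abstraction. -/
def lam : OTm (A :: Γ) B → OTm Γ (Ty.arr A B) := Quotient.map Term.lam fun _ _ => Conv.lam

/-- Application. -/
def app : OTm Γ (Ty.arr A B) → OTm Γ A → OTm Γ B :=
  Quotient.map₂ Term.app fun _ _ h _ _ h' => Conv.app h h'

/-- Pairing. -/
def pair : OTm Γ A → OTm Γ B → OTm Γ (Ty.prod A B) :=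
  Quotient.map₂ Term.pair fun _ _ h _ _ h' => Conv.pair h h'

/-- First projection. -/
def fst : OTm Γ (Ty.prod A B) → OTm Γ A := Quotient.map Term.fst fun _ _ => Conv.fst

/-- Second projection. -/
def snd : OTm Γ (Ty.prod A B) → OTm Γ B := Quotient.map Term.snd fun _ _ => Conv.snd

/-- The element of the unit type. -/
def star : OTm Γ Ty.unit := Term.star.cls

/-- Renaming. -/
def ren (ρ : Ren Γ Δ) : OTm Γ A → OTm Δ A := Quotient.map (Term.ren ρ) fun _ _ h => h.ren ρ

/-- Weakening by one variable. -/
def wk (B : Ty) (t : OTm Γ A) : OTm (B :: Γ) A := t.ren (Ren.wk Γ B)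

/-- The application of a closed term to a term in context. -/
def ap (f : Tm (Ty.arr A B)) (u : OTm Γ A) : OTm Γ B := app (f.ren (Ren.nil Γ)) u

@[simp] theorem fst_pair (t : OTm Γ A) (u : OTm Γ B) : fst (pair t u) = t := by
  induction t using ind; induction u using ind; exact sound (.beta_fst _ _)

@[simp] theorem snd_pair (t : OTm Γ A) (u : OTm Γ B) : snd (pair t u) = u := by
  induction t using ind; induction u using ind; exact sound (.beta_snd _ _)

@[simp] theorem pair_fst_snd (t : OTm Γ (Ty.prod A B)) : pair (fst t) (snd t) = t := by
  induction t using ind; exact (sound (.eta_pair _)).symm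

theorem eq_star (t : OTm Γ Ty.unit) : t = star := by
  induction t using ind; exact sound (.eta_star _)

@[simp] theorem lam_app_wk (t : OTm Γ (Ty.arr A B)) : lam (app (wk A t) (var .zero)) = t := by
  induction t using ind; exact (sound (.eta _)).symm

/-- Naturality of the application of a closed term. -/
theorem ren_ap (ρ : Ren Γ Δ) (f : Tm (Ty.arr A B)) (u : OTm Γ A) :
    ren ρ (ap f u) = ap f (ren ρ u) := by
  induction f using ind with | _ f
  induction u using ind with | _ u
  change ((Term.app (f.ren (Ren.nil Γ)) u).ren ρ).cls
    = (Term.app (f.ren (Ren.nil Δ)) (u.ren ρ)).cls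
  rw [Term.ren, Term.ren_ren, Term.ren_closed f (fun A x => ρ A (Ren.nil Γ A x))]

theorem wk_ap (C : Ty) (f : Tm (Ty.arr A B)) (u : OTm Γ A) : wk C (ap f u) = ap f (wk C u) :=
  ren_ap _ _ _

/-- A closed term of function type is determined by its application to terms in context. -/
theorem ap_ext {f g : Tm (Ty.arr A B)} (h : ∀ (Γ : List Ty) (u : OTm Γ A), ap f u = ap g u) :
    f = g := by
  have e : ∀ f : Tm (Ty.arr A B), f = lam (ap f (var .zero)) := fun f => by
    induction f using ind with | _ f
    have h := (lam_app_wk f.cls).symm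
    change f.cls = (Term.lam (Term.app (f.ren (Ren.wk [] A)) (Term.var .zero))).cls at h
    rw [Term.ren_closed] at h
    exact h
  rw [e f, e g, h]

/-- `β`-conversion for the application of a closed abstraction. -/
theorem ap_lam_cls (t : Term [A] B) (u : Term Γ A) :
    ap t.lam.cls u.cls = (t.sub (Sub.one u)).cls := by
  refine (sound (.beta _ u)).trans ?_
  rw [Term.sub_ren]
  refine congrArg (fun s : Sub [A] Γ => (t.sub s).cls) ?_
  funext A x
  cases x with
  | zero => rfl
  | succ x => nomatch x

end OTm

/-! ### The category of simply typed lambda-terms -/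

/-- The category whose objects are the simple types and whose morphisms from `A` to `B` are the
closed terms of type `A → B` modulo `βη`-conversion. -/
structure Lam where
  ty : Ty

namespace Lam

open OTm

/-- `λ x. x` -/
def idTm (A : Ty) : Tm (Ty.arr A A) := lam (var .zero)

/-- `λ x. g (f x)` -/
def compTm {A B C : Ty} (f : Tm (Ty.arr A B)) (g : Tm (Ty.arr B C)) : Tm (Ty.arr A C) :=
  lam (ap g (ap f (var .zero)))

/-- `λ x. ⟨⟩` -/
def toUnitTm (A : Ty) : Tm (Ty.arr A Ty.unit) := lam star

/-- `λ x. x₁` -/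
def fstTm (A B : Ty) : Tm (Ty.arr (Ty.prod A B) A) := lam (fst (var .zero))

/-- `λ x. x₂` -/
def sndTm (A B : Ty) : Tm (Ty.arr (Ty.prod A B) B) := lam (snd (var .zero))

/-- `λ x. ⟨f x, g x⟩` -/
def pairTm {A B C : Ty} (f : Tm (Ty.arr C A)) (g : Tm (Ty.arr C B)) :
    Tm (Ty.arr C (Ty.prod A B)) :=
  lam (pair (ap f (var .zero)) (ap g (var .zero)))

/-- `λ p. p₂ p₁` -/
def evTm (A B : Ty) : Tm (Ty.arr (Ty.prod A (Ty.arr A B)) B) :=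
  lam (app (snd (var .zero)) (fst (var .zero)))

/-- `λ y. λ x. f ⟨x, y⟩` -/
def curryTm {A B C : Ty} (f : Tm (Ty.arr (Ty.prod A C) B)) : Tm (Ty.arr C (Ty.arr A B)) :=
  lam (lam (ap f (pair (var .zero) (var (.succ .zero)))))

section

variable {Γ : List Ty} {A B C : Ty}

@[simp] theorem ap_idTm (u : OTm Γ A) : ap (idTm A) u = u := by
  induction u using ind with | _ u
  exact ap_lam_cls _ _

@[simp] theorem ap_compTm (f : Tm (Ty.arr A B)) (g : Tm (Ty.arr B C)) (u : OTm Γ A) :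
    ap (compTm f g) u = ap g (ap f u) := by
  induction f using ind with | _ f
  induction g using ind with | _ g
  induction u using ind with | _ u
  refine (ap_lam_cls (Term.app (g.ren _) (Term.app (f.ren _) (Term.var .zero))) u).trans ?_
  simp only [Term.sub, Term.sub_ren, Term.sub_closed]
  rfl

@[simp] theorem ap_fstTm (u : OTm Γ (Ty.prod A B)) : ap (fstTm A B) u = fst u := by
  induction u using ind with | _ u
  exact ap_lam_cls _ _

@[simp] theorem ap_sndTm (u : OTm Γ (Ty.prod A B)) : ap (sndTm A B) u = snd u := by
  induction u using ind with | _ u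
  exact ap_lam_cls _ _

@[simp] theorem ap_pairTm (f : Tm (Ty.arr C A)) (g : Tm (Ty.arr C B)) (u : OTm Γ C) :
    ap (pairTm f g) u = pair (ap f u) (ap g u) := by
  induction f using ind with | _ f
  induction g using ind with | _ g
  induction u using ind with | _ u
  refine (ap_lam_cls (Term.pair (Term.app (f.ren _) (Term.var .zero))
    (Term.app (g.ren _) (Term.var .zero))) u).trans ?_
  simp only [Term.sub, Term.sub_ren, Term.sub_closed]
  rfl

@[simp] theorem ap_evTm (u : OTm Γ (Ty.prod A (Ty.arr A B))) :
    ap (evTm A B) u = app (snd u) (fst u) := by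
  induction u using ind with | _ u
  exact ap_lam_cls _ _

@[simp] theorem ap_curryTm (f : Tm (Ty.arr (Ty.prod A C) B)) (u : OTm Γ C) :
    ap (curryTm f) u = lam (ap f (pair (var .zero) (wk A u))) := by
  induction f using ind with | _ f
  induction u using ind with | _ u
  refine (ap_lam_cls (Term.lam (Term.app (f.ren _)
    (Term.pair (Term.var .zero) (Term.var (.succ .zero))))) u).trans ?_
  simp only [Term.sub, Term.sub_ren, Term.sub_closed]
  rfl

/-- `β`-conversion for an abstraction of the form produced by currying. -/
theorem app_lam_ap (f : Tm (Ty.arr (Ty.prod A C) B)) (u : OTm Γ C) (w : OTm Γ A) :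
    app (lam (ap f (pair (var .zero) (wk A u)))) w = ap f (pair w u) := by
  induction f using ind with | _ f
  induction u using ind with | _ u
  induction w using ind with | _ w
  refine (sound (.beta (Term.app (f.ren _) (Term.pair (Term.var .zero) (u.wk A))) w)).trans ?_
  simp only [Term.sub, Term.sub_ren, Term.sub_closed, Term.wk_sub_inst]
  rfl

end

instance : Category Lam where
  Hom X Y := Tm (Ty.arr X.ty Y.ty)
  id X := idTm X.ty
  comp f g := compTm f g
  id_comp _ := ap_ext fun _ _ => by simp
  comp_id _ := ap_ext fun _ _ => by simp
  assoc _ _ _ := ap_ext fun _ _ => by simp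

instance : CartesianMonoidalCategory Lam :=
  mkCartesian ⟨Ty.unit⟩ (fun X => toUnitTm X.ty)
    (fun _ _ => ap_ext fun _ _ => (eq_star _).trans (eq_star _).symm)
    (fun X Y => ⟨Ty.prod X.ty Y.ty⟩) (fun X Y => fstTm X.ty Y.ty) (fun X Y => sndTm X.ty Y.ty)
    (fun f g => pairTm f g)
    (fun {T X Y} f g => ap_ext fun _ _ => by
      change ap (compTm (pairTm f g) (fstTm X.ty Y.ty)) _ = _
      simp)
    (fun {T X Y} f g => ap_ext fun _ _ => by
      change ap (compTm (pairTm f g) (sndTm X.ty Y.ty)) _ = _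
      simp)
    (fun {T X Y} h h' h₁ h₂ => ap_ext fun Γ u => by
      have e₁ := congrArg (fun f => ap f u) h₁
      have e₂ := congrArg (fun f => ap f u) h₂
      change ap (compTm h (fstTm X.ty Y.ty)) u = ap (compTm h' (fstTm X.ty Y.ty)) u at e₁
      change ap (compTm h (sndTm X.ty Y.ty)) u = ap (compTm h' (sndTm X.ty Y.ty)) u at e₂
      simp only [ap_compTm, ap_fstTm, ap_sndTm] at e₁ e₂
      rw [← pair_fst_snd (ap h u), e₁, e₂, pair_fst_snd])

theorem ap_whiskerLeft (X : Lam) {Y Z : Lam} (f : Y ⟶ Z) {Γ : List Ty}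
    (u : OTm Γ (Ty.prod X.ty Y.ty)) :
    ap (A := Ty.prod X.ty Y.ty) (B := Ty.prod X.ty Z.ty) (X ◁ f) u
      = pair (fst u) (ap f (snd u)) := by
  change ap (pairTm (compTm (fstTm X.ty Y.ty) (idTm X.ty)) (compTm (sndTm X.ty Y.ty) f)) u = _
  simp

instance : MonoidalClosed Lam :=
  mkClosed (fun X Y => ⟨Ty.arr X.ty Y.ty⟩) (fun X Y => evTm X.ty Y.ty)
    (fun {X Y Z} f => curryTm (A := X.ty) (B := Z.ty) (C := Y.ty) f)
    (fun {X Y Z} f => ap_ext fun Γ u => by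
      refine (ap_compTm _ _ u).trans ?_
      rw [ap_evTm]
      erw [ap_whiskerLeft]
      rw [snd_pair, fst_pair, ap_curryTm, app_lam_ap, pair_fst_snd])
    (fun {X Y Z} g => ap_ext fun Γ u => by
      rw [ap_curryTm]
      erw [ap_compTm]
      rw [ap_evTm]
      erw [ap_whiskerLeft]
      simp only [fst_pair, snd_pair, ← wk_ap, lam_app_wk])

/-- The point of the object `B` given by a closed term `t` of type `B`, namely `λ y. t`. -/
def point {B : Ty} (t : Tm B) : 𝟙_ Lam ⟶ ⟨B⟩ := lam (wk Ty.unit t)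

end Lam

/-! ### The encoding of finite ordinals -/

/-- The power `o ^ n` of the base type, with `o ^ 0` the unit type and `o ^ 1` the base type. -/
def Ty.pow : ℕ → Ty
  | 0 => Ty.unit
  | 1 => Ty.o
  | n + 2 => Ty.prod Ty.o (Ty.pow (n + 1))

/-- The projection of a term of type `o ^ n` to one of its coordinates. -/
def Term.proj {Γ : List Ty} : (n : ℕ) → Fin n → Term Γ (Ty.pow n) → Term Γ Ty.o
  | 0, i, _ => i.elim0
  | 1, _, t => t
  | _ + 2, ⟨0, _⟩, t => Term.fst t
  | n + 2, ⟨i + 1, h⟩, t => Term.proj (n + 1) ⟨i, Nat.lt_of_succ_lt_succ h⟩ (Term.snd t)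

/-- The type `o ^ n → o`, which encodes the finite ordinal `n`. -/
def finTy (n : ℕ) : Ty := Ty.arr (Ty.pow n) Ty.o

/-- The closed term `λ x. xᵢ` of type `o ^ n → o`. -/
def projTm {n : ℕ} (i : Fin n) : Tm (finTy n) :=
  (Term.lam (Term.proj n i (Term.var Var.zero))).cls

/-- The logical relation between `o ^ n → o` and `n` that relates the projection `πᵢ` to `i`. -/
def bij (n : ℕ) : LogRel Lam FinOrd where
  obj := (⟨finTy n⟩, ⟨n⟩)
  pred := {p | ∃ i : Fin n, p = (Lam.point (projTm i), FinOrd.point i)}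

end LamRel

/-! The second projection from $\mathcal R$ to $\mathbf{FinOrd}$ preserves products and exponentials
on the nose, and products, exponentials and composites of identities are identities. So the
target-identities are multiplicative and closed under products and under the exponential action in
both variances (`targetIdentities_tensorHom`, `targetIdentities_expMap`). Taking them as both left
and right morphisms makes the closure axioms hold.

It remains to compare, in both directions and over the identity of the finite ordinal,
$\mathrm{Bij}(1)$ with $1$, $\mathrm{Bij}(nm)$ with $\mathrm{Bij}(n)\times\mathrm{Bij}(m)$, and
$\mathrm{Bij}(m^n)$ with $\mathrm{Bij}(n)\Rightarrow\mathrm{Bij}(m)$. A morphism of this kind is a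
λ-term whose behaviour matters only on related points, so it need not be invertible: it only has to
send the code of each element to a code of the same element. A projection $\pi_i$ is a case
distinction, which applied to a tuple returns its $i$-th entry (`Conv.app_tuple`), and each
comparison term is a nest of such case distinctions.

The hardest direction reads a function $f$ off a term $t$ with $t\,\pi_i=\pi_{f(i)}$ for all $i$. As
$n$ is finite, $t$ can be queried at every $\pi_i$. Branching successively on the $n$ answers over a
tree with leaves $x_g$, for $g:n\to m$, ends at $x_f$ (`Conv.select`), and abstracting $x$ gives
$\pi_f$.

Points of $\mathbf{Lam}$ correspond bijectively to closed terms modulo conversion, so membership in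
each relation becomes a family of conversions (`mem_bij`, `mem_bij_tensor`, `mem_bij_exp`), which
the `conv_…` lemmas verify. -/

namespace LamRel

/-! ### Tuples and case distinctions -/

namespace Term

variable {Γ Δ : List Ty}

/-- The tuple of type `o ^ n` with given coordinates. -/
def tuple : (n : ℕ) → (Fin n → Term Γ Ty.o) → Term Γ (Ty.pow n)
  | 0, _ => star
  | 1, x => x 0
  | n + 2, x => pair (x 0) (tuple (n + 1) fun i => x i.succ)

/-- The term selecting, among the terms `x f` indexed by functions `f`, the one whose index
describes the selectors `q`. -/
def select {m : ℕ} : (k : ℕ) → (Fin k → Term Γ (finTy m)) →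
    ((Fin k → Fin m) → Term Γ Ty.o) → Term Γ Ty.o
  | 0, _, x => x Fin.elim0
  | k + 1, q, x => app (q 0) (tuple m fun a =>
      select k (fun i => q i.succ) fun f => x (Fin.cons a f))

/-- The `i`-th projection as a `λ`-abstraction. -/
def projLam {n : ℕ} (i : Fin n) : Term Γ (finTy n) := lam (proj n i (var Var.zero))

theorem sub_proj (σ : Sub Γ Δ) : ∀ (n : ℕ) (i : Fin n) (t : Term Γ (Ty.pow n)),
    (proj n i t).sub σ = proj n i (t.sub σ)
  | 0, i, _ => i.elim0
  | 1, _, _ => rfl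
  | _ + 2, ⟨0, _⟩, _ => rfl
  | n + 2, ⟨i + 1, h⟩, t => sub_proj σ (n + 1) ⟨i, Nat.lt_of_succ_lt_succ h⟩ (snd t)

theorem sub_tuple (σ : Sub Γ Δ) : ∀ (n : ℕ) (x : Fin n → Term Γ Ty.o),
    (tuple n x).sub σ = tuple n fun i => (x i).sub σ
  | 0, _ => rfl
  | 1, _ => rfl
  | n + 2, x => congrArg (pair ((x 0).sub σ)) (sub_tuple σ (n + 1) fun i => x i.succ)

theorem sub_select {m : ℕ} (σ : Sub Γ Δ) : ∀ (k : ℕ) (q : Fin k → Term Γ (finTy m))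
    (x : (Fin k → Fin m) → Term Γ Ty.o),
    (select k q x).sub σ = select k (fun i => (q i).sub σ) fun f => (x f).sub σ
  | 0, _, _ => rfl
  | k + 1, q, x => by
    refine congrArg (app ((q 0).sub σ)) ((sub_tuple σ m _).trans ?_)
    exact congrArg (tuple m) (funext fun a => sub_select σ k _ _)

/-- The body mentions only the bound variable, so projections move freely between contexts. -/
theorem sub_projLam {n : ℕ} (σ : Sub Γ Δ) (i : Fin n) : (projLam i).sub σ = projLam i :=
  congrArg lam (sub_proj _ n i _)

theorem ren_projLam {n : ℕ} (ρ : Ren Γ Δ) (i : Fin n) : (projLam i).ren ρ = projLam i := by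
  rw [ren_eq_sub, sub_projLam]

end Term

/-! ### Projections act as case distinctions, up to conversion -/

namespace Conv

open Term

variable {Γ Δ : List Ty}

theorem of_eq {A : Ty} {t u : Term Γ A} (h : t = u) : Conv t u := h ▸ .refl t

/-- Carries a hypothesis on a closed term under the binders of a comparison term. -/
theorem ren_projLam {n : ℕ} {i : Fin n} {t : Term Γ (finTy n)} (h : Conv t (projLam i))
    (ρ : Ren Γ Δ) : Conv (t.ren ρ) (projLam i) := by
  have h' := h.ren ρ
  rwa [Term.ren_projLam] at h'

theorem proj : ∀ (n : ℕ) (i : Fin n) {t u : Term Γ (Ty.pow n)}, Conv t u →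
    Conv (Term.proj n i t) (Term.proj n i u)
  | 0, i, _, _, _ => i.elim0
  | 1, _, _, _, h => h
  | _ + 2, ⟨0, _⟩, _, _, h => .fst h
  | n + 2, ⟨i + 1, hi⟩, _, _, h => proj (n + 1) ⟨i, Nat.lt_of_succ_lt_succ hi⟩ (.snd h)

theorem proj_tuple : ∀ (n : ℕ) (i : Fin n) (x : Fin n → Term Γ Ty.o),
    Conv (Term.proj n i (tuple n x)) (x i)
  | 0, i, _ => i.elim0
  | 1, i, x => by rw [Subsingleton.elim i 0]; exact .refl _
  | _ + 2, ⟨0, _⟩, _ => .beta_fst _ _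
  | n + 2, ⟨i + 1, h⟩, x =>
    (proj (n + 1) ⟨i, Nat.lt_of_succ_lt_succ h⟩ (.beta_snd _ _)).trans
      (proj_tuple (n + 1) ⟨i, Nat.lt_of_succ_lt_succ h⟩ fun i => x i.succ)

theorem app_tuple {n : ℕ} {i : Fin n} {t : Term Γ (finTy n)} (h : Conv t (projLam i))
    (x : Fin n → Term Γ Ty.o) : Conv (Term.app t (tuple n x)) (x i) := by
  refine (Conv.app h (.refl _)).trans ((Conv.beta _ _).trans ?_)
  rw [sub_proj]
  exact proj_tuple n i x

/-- Modulo conversion, substituting into `b` is applying the closed abstraction of `b`, and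
application respects conversion. This allows a point related to $i$ to be replaced by $\pi_i$
itself. -/
theorem sub_one {A B : Ty} (b : Term [A] B) {t u : Term Γ A} (h : Conv t u) :
    Conv (b.sub (Sub.one t)) (b.sub (Sub.one u)) := by
  refine Quotient.exact (s := convSetoid _ _)
    ((OTm.ap_lam_cls b t).symm.trans (Eq.trans ?_ (OTm.ap_lam_cls b u)))
  rw [OTm.sound h]

/-- Induction on the number of selectors: the first one picks the branch indexed by `f 0`, and the
remaining ones decide `Fin.tail f` inside that branch. -/
theorem select {m : ℕ} : ∀ (k : ℕ) (q : Fin k → Term Γ (finTy m))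
    (x : (Fin k → Fin m) → Term Γ Ty.o) (f : Fin k → Fin m),
    (∀ i, Conv (q i) (projLam (f i))) → Conv (Term.select k q x) (x f)
  | 0, _, x, f, _ => by rw [Subsingleton.elim f Fin.elim0]; exact .refl _
  | k + 1, q, x, f, h => by
    refine (app_tuple (h 0) _).trans ?_
    have h' := select k (fun i => q i.succ) (fun g => x (Fin.cons (f 0) g)) (Fin.tail f)
      fun i => h i.succ
    rwa [Fin.cons_self_tail] at h'

end Conv

/-! ### Points of the category of simply typed lambda-terms -/

namespace Lam

open OTm

variable {A B : Ty}

theorem ren_nil (t : Tm A) : t.ren (Ren.nil []) = t := by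
  induction t using ind with | _ t
  change (t.ren (Ren.nil [])).cls = t.cls
  rw [← Term.ren_closed t (fun _ x => x), Term.ren_eq_sub, Term.sub_var]

/-- `point t` is a constant function, so its argument disappears. -/
theorem ap_point (t : Tm B) {Γ : List Ty} (u : OTm Γ Ty.unit) :
    ap (A := Ty.unit) (B := B) (point t) u = t.ren (Ren.nil Γ) := by
  induction t using ind with | _ t
  induction u using ind with | _ u
  refine (ap_lam_cls (t.wk Ty.unit) u).trans ?_
  rw [Term.wk, Term.sub_ren, Term.sub_closed]
  rfl

theorem point_injective : Function.Injective (point (B := B)) := fun s t h => by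
  have h' := congrArg (fun p : 𝟙_ Lam ⟶ ⟨B⟩ => ap (A := Ty.unit) (B := B) p (star (Γ := []))) h
  simpa only [ap_point, ren_nil] using h'

theorem point_comp (t : Tm A) (f : (⟨A⟩ : Lam) ⟶ ⟨B⟩) :
    point t ≫ f = point (ap (A := A) (B := B) f t) := by
  refine ap_ext fun Γ u => (ap_compTm _ _ u).trans ?_
  erw [ap_point, ap_point]
  exact (ren_ap _ _ _).symm

/-- By η on the unit type every argument equals ⟨⟩, so a point is constant, with value its
application to ⟨⟩. -/
theorem point_surjective : Function.Surjective (point (B := B)) := fun p => by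
  refine ⟨ap (A := Ty.unit) (B := B) p star, ap_ext fun Γ u => ?_⟩
  erw [ap_point]
  rw [ren_ap, eq_star u]
  rfl

theorem lift_point (s : Tm A) (t : Tm B) :
    lift (point s) (point t) = point (pair s t) := by
  refine ap_ext fun Γ u => (ap_pairTm _ _ u).trans ?_
  erw [ap_point, ap_point, ap_point]
  induction s using ind with | _ s
  induction t using ind with | _ t
  rfl

theorem point_fst (t : Tm (Ty.prod A B)) :
    point t ≫ CartesianMonoidalCategory.fst (⟨A⟩ : Lam) ⟨B⟩ = point (OTm.fst t) :=
  (point_comp t (fstTm A B)).trans (congrArg point (ap_fstTm t))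

theorem point_snd (t : Tm (Ty.prod A B)) :
    point t ≫ CartesianMonoidalCategory.snd (⟨A⟩ : Lam) ⟨B⟩ = point (OTm.snd t) :=
  (point_comp t (sndTm A B)).trans (congrArg point (ap_sndTm t))

theorem lift_point_ev (s : Tm A) (t : Tm (Ty.arr A B)) :
    lift (point s) (point t) ≫ (ihom.ev (⟨A⟩ : Lam)).app ⟨B⟩ = point (app t s) := by
  rw [lift_point]
  refine (point_comp (pair s t) (evTm A B)).trans (congrArg point ?_)
  rw [ap_evTm, fst_pair, snd_pair]

/-- The morphism given by a term with one free variable. -/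
def ofTerm (t : Term [A] B) : (⟨A⟩ : Lam) ⟶ ⟨B⟩ := t.lam.cls

theorem point_ofTerm (s : Term [] A) (t : Term [A] B) :
    point s.cls ≫ ofTerm t = point (t.sub (Sub.one s)).cls :=
  (point_comp _ _).trans (congrArg point (ap_lam_cls t s))

end Lam

/-! ### Target-identities -/

section TargetIdentities

variable {C : Type u} [Category.{v} C] [CartesianMonoidalCategory C] [MonoidalClosed C]

theorem whiskerLeft_expMap_ev {a b c d : C} (f : a ⟶ b) (g : c ⟶ d) :
    a ◁ expMap f g ≫ (ihom.ev a).app d = f ▷ _ ≫ (ihom.ev b).app c ≫ g := by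
  rw [expMap, MonoidalCategory.whiskerLeft_comp, Category.assoc, ihom.ev_naturality,
    ← Category.assoc, MonoidalClosed.id_tensor_pre_app_comp_ev, Category.assoc]

/-- Uncurrying is injective, and under the hypothesis `f` and the identity both uncurry to
evaluation. -/
theorem eq_id_of_whiskerLeft_ev {a b : C} {f : (ihom a).obj b ⟶ (ihom a).obj b}
    (h : a ◁ f ≫ (ihom.ev a).app b = (ihom.ev a).app b) : f = 𝟙 _ := by
  apply MonoidalClosed.uncurry_injective
  rw [MonoidalClosed.uncurry_eq, MonoidalClosed.uncurry_eq, h, MonoidalCategory.whiskerLeft_id,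
    Category.id_comp]

variable {C₁ : Type u₁} [Category.{v₁} C₁] [CartesianMonoidalCategory C₁]
  {C₂ : Type u₂} [Category.{v₂} C₂] [CartesianMonoidalCategory C₂]

theorem targetIdentities_isMultiplicative : (targetIdentities C₁ C₂).IsMultiplicative where
  id_mem _ := ⟨rfl, rfl⟩
  comp_mem f g hf hg := by
    obtain ⟨h, hf⟩ := hf
    obtain ⟨h', hg⟩ := hg
    refine ⟨h.trans h', ?_⟩
    rw [Pred.comp_hom, prod_comp_snd, hf, hg, eqToHom_trans]

theorem targetIdentities_tensorHom {a b a' b' : LogRel C₁ C₂} (u : a ⟶ b) (u' : a' ⟶ b')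
    (hu : targetIdentities C₁ C₂ u) (hu' : targetIdentities C₁ C₂ u') :
    targetIdentities C₁ C₂ (u ⊗ₘ u') := by
  -- Splitting the objects turns the equalities of second components into equalities of variables;
  -- once these are substituted, the transports `eqToHom` are identities.
  obtain ⟨⟨a₁, a₂⟩, pa⟩ := a
  obtain ⟨⟨b₁, b₂⟩, pb⟩ := b
  obtain ⟨⟨a₁', a₂'⟩, pa'⟩ := a'
  obtain ⟨⟨b₁', b₂'⟩, pb'⟩ := b'
  obtain ⟨h, e⟩ := hu
  obtain ⟨h', e'⟩ := hu'
  dsimp only at h h'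
  subst h h'
  refine ⟨rfl, ?_⟩
  change lift (fst a₂ a₂' ≫ u.hom.2) (snd a₂ a₂' ≫ u'.hom.2) = 𝟙 _
  rw [e, e']
  simp

/-- The exponential action is characterised by its composite with evaluation. In the second
component, identities for `f` and `g` reduce this composite to evaluation itself. -/
theorem targetIdentities_expMap [MonoidalClosed C₁] [MonoidalClosed C₂]
    {a b c d : LogRel C₁ C₂} (f : a ⟶ b) (g : c ⟶ d)
    (hf : targetIdentities C₁ C₂ f) (hg : targetIdentities C₁ C₂ g) :
    targetIdentities C₁ C₂ (expMap f g) := by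
  have key := congrArg (fun k : a ⊗ (ihom b).obj c ⟶ d => k.hom.2) (whiskerLeft_expMap_ev f g)
  obtain ⟨⟨a₁, a₂⟩, pa⟩ := a
  obtain ⟨⟨b₁, b₂⟩, pb⟩ := b
  obtain ⟨⟨c₁, c₂⟩, pc⟩ := c
  obtain ⟨⟨d₁, d₂⟩, pd⟩ := d
  obtain ⟨h, e⟩ := hf
  obtain ⟨h', e'⟩ := hg
  dsimp only at h h'
  subst h h'
  refine ⟨rfl, eq_id_of_whiskerLeft_ev ?_⟩
  refine ((congrArg (fun k => k ≫ (ihom.ev a₂).app c₂)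
    (congrArg Prod.snd (Pred.whiskerLeft_hom _ (expMap f g)))).symm.trans key).trans ?_
  change lift (fst a₂ _ ≫ f.hom.2) (snd a₂ _ ≫ 𝟙 _) ≫ (ihom.ev a₂).app c₂ ≫ g.hom.2 = _
  rw [e, e']
  simp

end TargetIdentities


/-! ### Comparison morphisms between the encodings of finite ordinals -/

section Comparison

open Term

variable {n m : ℕ}

/-- `λ t. ⟨λ x. t ⟨x_i⟩_(i,j), λ y. t ⟨y_j⟩_(i,j)⟩` -/
def splitTerm (n m : ℕ) : Term [finTy (n * m)] (Ty.prod (finTy n) (finTy m)) :=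
  pair
    (lam (app (var (.succ .zero))
      (tuple (n * m) fun k => proj n (finProdFinEquiv.symm k).1 (var .zero))))
    (lam (app (var (.succ .zero))
      (tuple (n * m) fun k => proj m (finProdFinEquiv.symm k).2 (var .zero))))

/-- `λ p. λ x. p₁ ⟨p₂ ⟨x_(i,j)⟩_j⟩_i` -/
def mergeTerm (n m : ℕ) : Term [Ty.prod (finTy n) (finTy m)] (finTy (n * m)) :=
  lam (app (fst (var (.succ .zero))) (tuple n fun i =>
    app (snd (var (.succ .zero))) (tuple m fun j =>
      proj (n * m) (finProdFinEquiv (i, j)) (var .zero))))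

/-- `λ t. λ d. λ x. t ⟨d ⟨x_(f i)⟩_i⟩_f` -/
def applyTerm (n m : ℕ) : Term [finTy (m ^ n)] (Ty.arr (finTy n) (finTy m)) :=
  lam (lam (app (var (.succ (.succ .zero))) (tuple (m ^ n) fun k =>
    app (var (.succ .zero)) (tuple n fun i =>
      proj m (finFunctionFinEquiv.symm k i) (var .zero)))))

/-- `λ t. λ x. t π_1 ⟨t π_2 ⟨… x_f …⟩_(f 2)⟩_(f 1)` -/
def tabulateTerm (n m : ℕ) : Term [Ty.arr (finTy n) (finTy m)] (finTy (m ^ n)) :=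
  lam (select n (fun i => app (var (.succ .zero)) (projLam i)) fun f =>
    proj (m ^ n) (finFunctionFinEquiv f) (var .zero))

/-! ### Values of the comparison terms on codes -/

theorem conv_splitTerm (k : Fin (n * m)) :
    Conv ((splitTerm n m).sub (Sub.one (projLam k)))
      (pair (projLam (Γ := []) (finProdFinEquiv.symm k).1)
        (projLam (finProdFinEquiv.symm k).2)) := by
  simp only [splitTerm, sub, sub_tuple, sub_proj]
  exact .pair (.lam (.app_tuple (.of_eq (ren_projLam _ k)) _))
    (.lam (.app_tuple (.of_eq (ren_projLam _ k)) _))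

theorem conv_mergeTerm {t : Term [] (Ty.prod (finTy n) (finTy m))} {k : Fin (n * m)}
    (h₁ : Conv (fst t) (projLam (finProdFinEquiv.symm k).1))
    (h₂ : Conv (snd t) (projLam (finProdFinEquiv.symm k).2)) :
    Conv ((mergeTerm n m).sub (Sub.one t)) (projLam k) := by
  simp only [mergeTerm, sub, sub_tuple, sub_proj]
  -- The component `p₁` selects the row and `p₂` the entry in that row; the pair of indices
  -- reassembles to `k`.
  have e := Conv.lam ((Conv.app_tuple (h₁.ren_projLam (Ren.wk [] (Ty.pow (n * m)))) fun i =>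
      app (snd (t.wk _)) (tuple m fun j =>
        proj (n * m) (finProdFinEquiv (i, j)) (var .zero))).trans
    (Conv.app_tuple (h₂.ren_projLam (Ren.wk [] (Ty.pow (n * m)))) _))
  rwa [Prod.mk.eta, Equiv.apply_symm_apply] at e

theorem conv_applyTerm (k : Fin (m ^ n)) (i : Fin n) :
    Conv (app ((applyTerm n m).sub (Sub.one (projLam k))) (projLam (Γ := []) i))
      (projLam (finFunctionFinEquiv.symm k i)) := by
  refine (Conv.beta _ _).trans ?_
  simp only [sub, sub_tuple, sub_proj]
  refine .lam ((Conv.app_tuple (i := k) (.of_eq ?_) _).trans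
    (Conv.app_tuple (.of_eq (ren_projLam _ i)) _))
  -- The substituted projection was weakened under two binders, and the β-step then instantiated the
  -- outer one; none of this affects it.
  change (((projLam k).ren _).ren _).sub _ = _
  rw [ren_projLam, ren_projLam, sub_projLam]

/-- The selectors are the answers of `t` to the `n` projections, so the case distinction reaches the
leaf indexed by the function that `k` encodes. -/
theorem conv_tabulateTerm {t : Term [] (Ty.arr (finTy n) (finTy m))} {k : Fin (m ^ n)}
    (h : ∀ i, Conv (app t (projLam i)) (projLam (finFunctionFinEquiv.symm k i))) :
    Conv ((tabulateTerm n m).sub (Sub.one t)) (projLam k) := by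
  simp only [tabulateTerm, sub, sub_select, sub_proj, sub_projLam]
  have e := Conv.lam (Conv.select n (fun i => app (t.wk (Ty.pow (m ^ n))) (projLam i))
    (fun f => proj (m ^ n) (finFunctionFinEquiv f) (var .zero)) _ fun i => by
      have h' := (h i).ren_projLam (Ren.wk [] (Ty.pow (m ^ n)))
      rwa [ren, ren_projLam] at h')
  rwa [Equiv.apply_symm_apply] at e

/-! ### Points of finite ordinals and membership in the relations -/

theorem FinOrd.point_surjective : Function.Surjective (FinOrd.point (n := n)) := fun p =>
  ⟨p.toFun (0 : Fin 1), FinOrd.hom_ext fun (i : Fin 1) => by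
    rw [Subsingleton.elim i (0 : Fin 1)]; rfl⟩

theorem FinOrd.point_injective : Function.Injective (FinOrd.point (n := n)) := fun _ _ h =>
  congrFun (congrArg FinOrd.Hom.toFun h) (0 : Fin 1)

theorem FinOrd.lift_point_ev (i : Fin n) (k : Fin (m ^ n)) :
    lift (FinOrd.point i) (FinOrd.point k) ≫ (ihom.ev (⟨n⟩ : FinOrd)).app ⟨m⟩
      = FinOrd.point (finFunctionFinEquiv.symm k i) :=
  FinOrd.hom_ext fun _ => by
    change finFunctionFinEquiv.symm (finProdFinEquiv.symm (finProdFinEquiv (i, k))).2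
      (finProdFinEquiv.symm (finProdFinEquiv (i, k))).1 = _
    rw [Equiv.symm_apply_apply]
    rfl

/-- Distinct elements, and distinct conversion classes, give distinct points. The point enters
through equations so that the lemma also applies to composites with projections or evaluation. -/
theorem mem_bij {p : 𝟙_ (Lam × FinOrd) ⟶ (bij n).obj} {t : Term [] (finTy n)} {i : Fin n}
    (h₁ : p.1 = Lam.point t.cls) (h₂ : p.2 = FinOrd.point i) :
    p ∈ (bij n).pred ↔ Conv t (projLam i) := by
  constructor
  · rintro ⟨j, rfl⟩
    obtain rfl := FinOrd.point_injective h₂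
    exact (Quotient.exact (Lam.point_injective h₁)).symm
  · exact fun h => ⟨i, Prod.ext (h₁.trans (congrArg Lam.point (OTm.sound h))) h₂⟩

theorem mem_bij_tensor {p : 𝟙_ (Lam × FinOrd) ⟶ (bij n ⊗ bij m).obj}
    {t : Term [] (Ty.prod (finTy n) (finTy m))} {k : Fin (n * m)}
    (h₁ : p.1 = Lam.point t.cls) (h₂ : p.2 = FinOrd.point k) :
    p ∈ (bij n ⊗ bij m).pred ↔ Conv (fst t) (projLam (finProdFinEquiv.symm k).1) ∧
      Conv (snd t) (projLam (finProdFinEquiv.symm k).2) := by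
  obtain ⟨p, q⟩ := p
  obtain rfl : p = Lam.point t.cls := h₁
  obtain rfl : q = FinOrd.point k := h₂
  exact and_congr (mem_bij (Lam.point_fst (A := finTy n) (B := finTy m) t.cls) rfl)
    (mem_bij (Lam.point_snd (A := finTy n) (B := finTy m) t.cls) rfl)

/-- The related points of $\mathrm{Bij}(n)$ are exactly the pairs $(\pi_i,i)$, so testing on all of
them means testing on each index `i`. -/
theorem mem_bij_exp {p : 𝟙_ (Lam × FinOrd) ⟶ ((ihom (bij n)).obj (bij m)).obj}
    {t : Term [] (Ty.arr (finTy n) (finTy m))} {k : Fin (m ^ n)}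
    (h₁ : p.1 = Lam.point t.cls) (h₂ : p.2 = FinOrd.point k) :
    p ∈ ((ihom (bij n)).obj (bij m)).pred ↔
      ∀ i, Conv (app t (projLam i)) (projLam (finFunctionFinEquiv.symm k i)) := by
  obtain ⟨p, q⟩ := p
  obtain rfl : p = Lam.point t.cls := h₁
  obtain rfl : q = FinOrd.point k := h₂
  have key (i : Fin n) := mem_bij (n := m) (i := finFunctionFinEquiv.symm k i)
    (t := app t (projLam i))
    (p := (lift (Lam.point (projTm i)) (Lam.point t.cls) ≫ (ihom.ev _).app _,
      lift (FinOrd.point i) (FinOrd.point k) ≫ (ihom.ev _).app _))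
    (Lam.lift_point_ev (projTm i) t.cls) (FinOrd.lift_point_ev i k)
  constructor
  · exact fun h i => (key i).1 (h _ ⟨i, rfl⟩)
  · rintro h _ ⟨i, rfl⟩
    exact (key i).2 (h i)

/-! ### The comparison morphisms -/

theorem exists_point {B : Ty} (p : 𝟙_ (Lam × FinOrd) ⟶ ((⟨B⟩, ⟨n⟩) : Lam × FinOrd)) :
    ∃ (t : Term [] B) (i : Fin n), p = (Lam.point t.cls, FinOrd.point i) := by
  obtain ⟨p, q⟩ := p
  obtain ⟨t, rfl⟩ := Lam.point_surjective p
  obtain ⟨i, rfl⟩ := FinOrd.point_surjective q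
  induction t using OTm.ind with | _ t
  exact ⟨t, i, rfl⟩

/-- Reduces a comparison to one computation on closed terms, with the same `i` on both sides. The
equations `hX` and `hY` present units, products and exponentials as explicit triples. -/
theorem exists_targetIdentity {X Y : LogRel Lam FinOrd} {A B : Ty}
    {P : Set (𝟙_ (Lam × FinOrd) ⟶ ((⟨A⟩, ⟨n⟩) : Lam × FinOrd))}
    {Q : Set (𝟙_ (Lam × FinOrd) ⟶ ((⟨B⟩, ⟨n⟩) : Lam × FinOrd))}
    (hX : X = ⟨(⟨A⟩, ⟨n⟩), P⟩) (hY : Y = ⟨(⟨B⟩, ⟨n⟩), Q⟩) (b : Term [A] B)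
    (h : ∀ (t : Term [] A) (i : Fin n), (Lam.point t.cls, FinOrd.point i) ∈ P →
      (Lam.point (b.sub (Sub.one t)).cls, FinOrd.point i) ∈ Q) :
    ∃ f : X ⟶ Y, targetIdentities Lam FinOrd f := by
  subst hX hY
  refine ⟨⟨(Lam.ofTerm b, 𝟙 _), fun p hp => ?_⟩, rfl, rfl⟩
  obtain ⟨t, i, rfl⟩ := exists_point p
  refine Set.mem_of_eq_of_mem (Prod.ext ?_ ?_) (h t i hp)
  · exact Lam.point_ofTerm t b
  · rfl

theorem exists_bij_one_to_unit :
    ∃ f : bij 1 ⟶ 𝟙_ (LogRel Lam FinOrd), targetIdentities Lam FinOrd f :=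
  exists_targetIdentity rfl rfl star fun _ _ _ => trivial

theorem exists_unit_to_bij_one :
    ∃ f : 𝟙_ (LogRel Lam FinOrd) ⟶ bij 1, targetIdentities Lam FinOrd f :=
  exists_targetIdentity rfl rfl (projLam (0 : Fin 1)) fun _ i _ => (mem_bij rfl rfl).2 (by
    rw [sub_projLam, Subsingleton.elim i (0 : Fin 1)]
    exact .refl _)

theorem exists_bij_mul_to_tensor (n m : ℕ) :
    ∃ f : bij (n * m) ⟶ bij n ⊗ bij m, targetIdentities Lam FinOrd f :=
  exists_targetIdentity rfl rfl (splitTerm n m) fun t k h => by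
    have e := (Conv.sub_one (splitTerm n m) ((mem_bij rfl rfl).1 h)).trans (conv_splitTerm k)
    exact (mem_bij_tensor rfl rfl).2
      ⟨(Conv.fst e).trans (.beta_fst _ _), (Conv.snd e).trans (.beta_snd _ _)⟩

theorem exists_tensor_to_bij_mul (n m : ℕ) :
    ∃ f : bij n ⊗ bij m ⟶ bij (n * m), targetIdentities Lam FinOrd f :=
  exists_targetIdentity rfl rfl (mergeTerm n m) fun _ _ h =>
    have h' := (mem_bij_tensor rfl rfl).1 h
    (mem_bij rfl rfl).2 (conv_mergeTerm h'.1 h'.2)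

theorem exists_bij_pow_to_exp (n m : ℕ) :
    ∃ f : bij (m ^ n) ⟶ (ihom (bij n)).obj (bij m), targetIdentities Lam FinOrd f :=
  exists_targetIdentity rfl rfl (applyTerm n m) fun _ k h =>
    (mem_bij_exp rfl rfl).2 fun i => (Conv.app
      (Conv.sub_one (applyTerm n m) ((mem_bij rfl rfl).1 h)) (.refl _)).trans (conv_applyTerm k i)

theorem exists_exp_to_bij_pow (n m : ℕ) :
    ∃ f : (ihom (bij n)).obj (bij m) ⟶ bij (m ^ n), targetIdentities Lam FinOrd f :=
  exists_targetIdentity rfl rfl (tabulateTerm n m) fun _ _ h =>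
    (mem_bij rfl rfl).2 (conv_tabulateTerm ((mem_bij_exp rfl rfl).1 h))

end Comparison

/-- The squeezing structure on the logical relations from `λ`-terms to finite ordinals. -/
def squeezing : SqueezingStructure (LogRel Lam FinOrd) where
  left := targetIdentities Lam FinOrd
  right := targetIdentities Lam FinOrd
  left_multiplicative := targetIdentities_isMultiplicative
  right_multiplicative := targetIdentities_isMultiplicative
  left_prod := targetIdentities_tensorHom
  right_prod := targetIdentities_tensorHom
  left_exp u v hu hv := targetIdentities_expMap v u hv hu
  right_exp u v hu hv := targetIdentities_expMap u v hu hv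
  L c := bij c.obj.2.card
  R c := bij c.obj.2.card
  -- The cardinals of the unit, products and exponentials are by definition `1`, `n * m` and `m ^
  -- n`, so the comparisons apply without transport.
  L_unit := exists_bij_one_to_unit
  L_prod _ _ := exists_bij_mul_to_tensor _ _
  L_exp _ _ := exists_bij_pow_to_exp _ _
  R_unit := exists_unit_to_bij_one
  R_prod _ _ := exists_tensor_to_bij_mul _ _
  R_exp _ _ := exists_exp_to_bij_pow _ _

end LamRel

theorem mainTheorem6 :
    ∃ S : LamRel.SqueezingStructure (LamRel.LogRel LamRel.Lam LamRel.FinOrd),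
      S.left = LamRel.targetIdentities LamRel.Lam LamRel.FinOrd ∧
      S.right = LamRel.targetIdentities LamRel.Lam LamRel.FinOrd ∧
      ∀ c : LamRel.LogRel LamRel.Lam LamRel.FinOrd,
        S.L c = LamRel.bij c.obj.2.card ∧ S.R c = LamRel.bij c.obj.2.card :=
  ⟨LamRel.squeezing, rfl, rfl, fun _ => ⟨rfl, rfl⟩⟩
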